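/- Let $0<\epsilon\le 1$ and let $d$ be a natural number with $d\ge 10/\epsilon$. Write $\log$ for the logarithm to base $2$ and put $$ d_{A_2}=\Big\lceil \tfrac{112\ln 2}{\epsilon^2}\, d\log d\Big\rceil,\qquad n=\Big\lceil \tfrac{13440(\ln 2)^2}{\epsilon^5}\, d^3(\log d)^2\Big\rceil . $$ Let $\mathcal H_{A_2}$ and $\mathcal H_B$ be complex Hilbert spaces with $\dim\mathcal H_{A_2}=d_{A_2}$ and $\dim\mathcal H_B=d$. Then $d^2\le d_{A_2}d$, and for every natural number $m\le d_{A_2}d$ there exist $n$ isometries $U_1,\dots,U_n:\mathbb C^m\to\mathcal H_{A_2}\otimes\mathcal H_B$ such that, for every finite-dimensional Hilbert space $\mathcal H_{A_1}$ and every unit vector $|\psi\rangle\in\mathcal H_{A_1}\otimes\mathbb C^m$, $$ \frac1n\,\#\Big\{k\in\{1,\dots,n\} : \big\|\mathrm{Tr}_{A_1A_2}\,(I_{A_1}\otimes U_k)\,|\psi\rangle\langle\psi|\,(I_{A_1}\otimes U_k)^\dagger\big\|_\infty<\frac{1+\epsilon}{d}\Big\}\ \ge\ 1-\epsilon , $$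 where $\|\cdot\|_\infty$ is the operator norm. In particular this holds for $m=d^2$ (isometries that take $d^2$-dimensional states into $\mathcal H_{A_2}\otimes\mathcal H_B$) and for $m=d_{A_2}d$ (unitaries of $\mathcal H_{A_2}\otimes\mathcal H_B$ and arbitrary pure states of $A_1A_2B$). -/

import Mathlib

open scoped Kronecker

namespace SuperdenseCoding

/-- The density matrix `|ψ⟩⟨ψ|` of a vector `ψ` of `ℂ^ι`. -/
noncomputable def ketBra {ι : Type*} (ψ : EuclideanSpace ℂ ι) : Matrix ι ι ℂ :=
  Matrix.vecMulVec (fun i => ψ i) (fun i => star (ψ i))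

/-- The partial trace over the first factor of `ℂ^α ⊗ ℂ^β = ℂ^(α × β)`. -/
def traceLeft {α β : Type*} [Fintype α] (M : Matrix (α × β) (α × β) ℂ) : Matrix β β ℂ :=
  Matrix.of fun b b' => ∑ a, M (a, b) (a, b')

/-- The operator norm `‖M‖_∞` of a matrix acting on the Hilbert space `ℂ^β`. -/
noncomputable def opNorm {β : Type*} [Fintype β] [DecidableEq β] (M : Matrix β β ℂ) : ℝ :=
  ‖Matrix.toEuclideanCLM (n := β) (𝕜 := ℂ) M‖

/-- The matrix `U` represents an isometry `ℂ^ι → ℂ^κ`, i.e. `U† U = I`. -/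
def IsIsometry {κ ι : Type*} [Fintype κ] [DecidableEq ι] (U : Matrix κ ι ℂ) : Prop :=
  U.conjTranspose * U = 1

/-- The state `Tr_{A₁A₂} (I_{A₁} ⊗ U) |ψ⟩⟨ψ| (I_{A₁} ⊗ U)†` of `B`, where `α₁`, `α₂`, `β` index
orthonormal bases of `A₁`, `A₂`, `B`, and `ι` one of the space on which `U` is defined. -/
noncomputable def reducedState {α₁ α₂ β ι : Type*} [Fintype α₁] [DecidableEq α₁] [Fintype α₂]
    [Fintype ι] (U : Matrix (α₂ × β) ι ℂ) (ψ : EuclideanSpace ℂ (α₁ × ι)) : Matrix β β ℂ :=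
  let V : Matrix (α₁ × α₂ × β) (α₁ × ι) ℂ := (1 : Matrix α₁ α₁ ℂ) ⊗ₖ U
  traceLeft (traceLeft (V * ketBra ψ * V.conjTranspose))

/-- The dimension `(112 ln 2 / ε²) d log₂ d` of `A₂`, rounded up to an integer. -/
noncomputable def dimA₂ (ε : ℝ) (d : ℕ) : ℕ :=
  ⌈112 * Real.log 2 / ε ^ 2 * (d * Real.logb 2 d)⌉₊

/-- The number `(13440 (ln 2)² / ε⁵) d³ (log₂ d)²` of isometries, rounded up to an integer. -/
noncomputable def numIsometries (ε : ℝ) (d : ℕ) : ℕ :=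
  ⌈13440 * Real.log 2 ^ 2 / ε ^ 5 * ((d : ℝ) ^ 3 * Real.logb 2 d ^ 2)⌉₊

end SuperdenseCoding

/-!
The `U k` are independent Haar unitaries of `A₂ ⊗ B`, restricted to `m` coordinates. For a unit
vector `x` of `A₂ ⊗ B` the reduced state of `U x` on `B` has norm `‖C‖²`, where `C` is the
coefficient matrix of `U x`. Comparing `‖C‖` with the contractions of `U x` by Gaussian vectors
bounds all even moments of `‖C‖` under Haar measure, and a moment of order `t ≈ ε dim A₂` shows
that the mean excess of `‖C‖²` over `(1 + ε / 2) / d` is at most `d⁻³`. By an exponential moment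
estimate and a union bound over a net of the unit sphere, some choice of the `U k` has total excess
at most `n ε² / (2 d)` for all `x` simultaneously.

A bound on the total excess, unlike one on the number of bad `k`, is additive in the slices of a
state `ψ` of `A₁ ⊗ ℂᵐ` along a basis of `A₁`, so it passes to `ψ` without any loss depending on the
dimension of `A₁`. Markov's inequality over `k` then leaves at most `ε n` values of `k` for which
the norm reaches `(1 + ε) / d`.
-/

namespace SuperdenseCoding

open MeasureTheory ProbabilityTheory Module ENNReal Matrix

section Gaussian

variable (V : Type*) [NormedAddCommGroup V] [InnerProductSpace ℝ V] [FiniteDimensional ℝ V]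
  [MeasurableSpace V] [BorelSpace V]

theorem integral_exp_neg_sq_norm_half_pos : 0 < ∫ x : V, Real.exp (-(‖x‖ ^ 2 / 2)) := by
  have h := GaussianFourier.integral_rexp_neg_mul_sq_norm (V := V) (b := 1 / 2) (by norm_num)
  simp only [one_div, neg_mul, inv_mul_eq_div] at h
  rw [h]
  positivity

theorem integrable_exp_neg_sq_norm_half : Integrable fun x : V => Real.exp (-(‖x‖ ^ 2 / 2)) :=
  .of_integral_ne_zero (integral_exp_neg_sq_norm_half_pos V).ne'

theorem integral_exp_neg_sq_norm_half_mul_cexp (t : V) :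
    ∫ x : V, (Real.exp (-(‖x‖ ^ 2 / 2)) : ℂ) * Complex.exp (inner ℝ x t * Complex.I) =
      (∫ x : V, Real.exp (-(‖x‖ ^ 2 / 2)) : ℝ) * Complex.exp (-‖t‖ ^ 2 / 2) := by
  have hmass := GaussianFourier.integral_cexp_neg_mul_sq_norm (V := V) (b := 1 / 2) (by simp)
  have hchar := GaussianFourier.integral_cexp_neg_mul_sq_norm_add (V := V) (b := 1 / 2) (by simp)
    Complex.I t
  rw [← hmass] at hchar
  convert hchar using 1
  · refine integral_congr_ae (.of_forall fun x => ?_)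
    simp only [Complex.ofReal_exp, ← Complex.exp_add, real_inner_comm x t]
    push_cast
    ring_nf
  · rw [← integral_complex_ofReal, Complex.I_sq]
    push_cast
    ring_nf

theorem stdGaussian_eq_withDensity :
    stdGaussian V = volume.withDensity fun x => ENNReal.ofReal
      (Real.exp (-(‖x‖ ^ 2 / 2)) / ∫ y : V, Real.exp (-(‖y‖ ^ 2 / 2))) := by
  have hpos := integral_exp_neg_sq_norm_half_pos V
  have hint := (integrable_exp_neg_sq_norm_half V).div_const (∫ y : V, Real.exp (-(‖y‖ ^ 2 / 2)))
  have := isFiniteMeasure_withDensity_ofReal hint.2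
  refine Measure.ext_of_charFun (funext fun t => ?_)
  rw [charFun_stdGaussian, charFun_apply, integral_withDensity_eq_integral_toReal_smul (by fun_prop)
    (.of_forall fun _ => ENNReal.ofReal_lt_top)]
  have hfun : ∀ x : V, (ENNReal.ofReal
      (Real.exp (-(‖x‖ ^ 2 / 2)) / ∫ y : V, Real.exp (-(‖y‖ ^ 2 / 2)))).toReal •
        Complex.exp (inner ℝ x t * Complex.I) =
      (Real.exp (-(‖x‖ ^ 2 / 2)) : ℂ) * Complex.exp (inner ℝ x t * Complex.I) /
        (∫ y : V, Real.exp (-(‖y‖ ^ 2 / 2)) : ℝ) := fun x => by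
    rw [ENNReal.toReal_ofReal (by positivity), Complex.real_smul, Complex.ofReal_div]
    ring
  simp_rw [hfun]
  rw [integral_div, integral_exp_neg_sq_norm_half_mul_cexp,
    mul_div_cancel_left₀ _ (by exact_mod_cast hpos.ne')]

variable {V}

theorem integral_rpow_add_two_mul_exp_neg_sq_half {q : ℝ} (hq : -1 < q) :
    ∫ y in Set.Ioi (0 : ℝ), y ^ (q + 2) * Real.exp (-(y ^ 2 / 2)) =
      (q + 1) * ∫ y in Set.Ioi (0 : ℝ), y ^ q * Real.exp (-(y ^ 2 / 2)) := by
  have hΓ {p : ℝ} (hp : -1 < p) : ∫ y in Set.Ioi (0 : ℝ), y ^ p * Real.exp (-(y ^ 2 / 2)) =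
      (1 / 2) ^ (-(p + 1) / 2) * (1 / 2) * Real.Gamma ((p + 1) / 2) := by
    have h := integral_rpow_mul_exp_neg_mul_rpow two_pos hp (b := 1 / 2) (by norm_num)
    simpa only [Real.rpow_two, neg_mul, one_div, inv_mul_eq_div] using h
  rw [hΓ hq, hΓ (by linarith), show (q + 2 + 1) / 2 = (q + 1) / 2 + 1 by ring,
    Real.Gamma_add_one (by linarith), show -(q + 2 + 1) / 2 = -(q + 1) / 2 - 1 by ring,
    Real.rpow_sub_one (by norm_num)]
  ring

theorem integral_fun_norm_stdGaussian [Nontrivial V] (f : ℝ → ℝ) :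
    ∫ x, f ‖x‖ ∂stdGaussian V =
      finrank ℝ V * (volume : Measure V).real (Metric.ball 0 1) /
          (∫ x : V, Real.exp (-(‖x‖ ^ 2 / 2))) *
        ∫ y in Set.Ioi (0 : ℝ), y ^ (finrank ℝ V - 1) * (f y * Real.exp (-(y ^ 2 / 2))) := by
  rw [stdGaussian_eq_withDensity, integral_withDensity_eq_integral_toReal_smul (by fun_prop)
    (.of_forall fun _ => ENNReal.ofReal_lt_top)]
  have hfun : ∀ x : V, (ENNReal.ofReal
      (Real.exp (-(‖x‖ ^ 2 / 2)) / ∫ y : V, Real.exp (-(‖y‖ ^ 2 / 2)))).toReal • f ‖x‖ =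
      f ‖x‖ * Real.exp (-(‖x‖ ^ 2 / 2)) / ∫ y : V, Real.exp (-(‖y‖ ^ 2 / 2)) := fun x => by
    rw [ENNReal.toReal_ofReal (by positivity), smul_eq_mul]
    ring
  simp_rw [hfun]
  rw [integral_div, integral_fun_norm_addHaar (volume : Measure V)
    fun y => f y * Real.exp (-(y ^ 2 / 2))]
  simp only [nsmul_eq_mul, smul_eq_mul]
  ring

theorem integral_norm_pow_stdGaussian_succ [Nontrivial V] (t : ℕ) :
    ∫ x, ‖x‖ ^ (2 * (t + 1)) ∂stdGaussian V =
      (finrank ℝ V + 2 * t) * ∫ x, ‖x‖ ^ (2 * t) ∂stdGaussian V := by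
  have hn : (0 : ℝ) < finrank ℝ V := by exact_mod_cast finrank_pos (R := ℝ) (M := V)
  have hradial (s : ℕ) :
      ∫ y in Set.Ioi (0 : ℝ), y ^ (finrank ℝ V - 1) * (y ^ (2 * s) * Real.exp (-(y ^ 2 / 2))) =
        ∫ y in Set.Ioi (0 : ℝ), y ^ (finrank ℝ V - 1 + 2 * s : ℝ) * Real.exp (-(y ^ 2 / 2)) := by
    refine setIntegral_congr_fun measurableSet_Ioi fun y _ => ?_
    have hexp : (finrank ℝ V - 1 + 2 * s : ℝ) = (finrank ℝ V - 1 + 2 * s : ℕ) := by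
      push_cast [Nat.cast_sub (finrank_pos (R := ℝ) (M := V))]
      ring
    simp only [← mul_assoc, ← pow_add, hexp, Real.rpow_natCast]
  rw [integral_fun_norm_stdGaussian (· ^ (2 * (t + 1))),
    integral_fun_norm_stdGaussian (· ^ (2 * t)), hradial, hradial]
  have hrec := integral_rpow_add_two_mul_exp_neg_sq_half (q := finrank ℝ V - 1 + 2 * t)
    (by have := t.cast_nonneg (α := ℝ); linarith)
  rw [show (finrank ℝ V - 1 + 2 * (t + 1 : ℕ) : ℝ) = finrank ℝ V - 1 + 2 * t + 2 by push_cast; ring,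
    hrec]
  ring

theorem integral_norm_pow_stdGaussian [Nontrivial V] (t : ℕ) :
    ∫ x, ‖x‖ ^ (2 * t) ∂stdGaussian V = ∏ i ∈ Finset.range t, (finrank ℝ V + 2 * i : ℝ) := by
  induction t with
  | zero => simp
  | succ t ih => rw [integral_norm_pow_stdGaussian_succ, ih, Finset.prod_range_succ, mul_comm]

theorem lintegral_enorm_pow_stdGaussian [Nontrivial V] (t : ℕ) :
    ∫⁻ x, ‖x‖ₑ ^ (2 * t) ∂stdGaussian V =
      (∏ i ∈ Finset.range t, (finrank ℝ V + 2 * i) : ℕ) := by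
  have hmem := IsGaussian.memLp_id (stdGaussian V) (2 * t : ℕ) (ENNReal.natCast_ne_top _)
  have hint : Integrable (fun x : V => ‖x‖ ^ (2 * t)) (stdGaussian V) := hmem.integrable_norm_pow'
  have h := ofReal_integral_eq_lintegral_ofReal hint (.of_forall fun x => by positivity)
  rw [integral_norm_pow_stdGaussian] at h
  simp_rw [ENNReal.ofReal_pow (norm_nonneg _), ofReal_norm] at h
  rw [← h, ← ENNReal.ofReal_natCast]
  push_cast
  rfl

variable {W : Type*} [NormedAddCommGroup W] [InnerProductSpace ℝ W] [FiniteDimensional ℝ W]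
  [MeasurableSpace W] [BorelSpace W]

theorem map_stdGaussian_of_norm_adjoint_eq {L : V →L[ℝ] W} {c : ℝ}
    (hL : ∀ w, ‖L.adjoint w‖ = c * ‖w‖) :
    (stdGaussian V).map L = (stdGaussian W).map (c • ·) := by
  have := Measure.isProbabilityMeasure_map (μ := stdGaussian V) (f := L) (by fun_prop)
  have := Measure.isProbabilityMeasure_map (μ := stdGaussian W) (f := (c • ·)) (by fun_prop)
  refine Measure.ext_of_charFun (funext fun w => ?_)
  rw [charFun_map_smul, charFun_stdGaussian, charFun_apply,
    integral_map (by fun_prop) (by fun_prop)]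
  simp_rw [← ContinuousLinearMap.adjoint_inner_right]
  rw [← charFun_apply, charFun_stdGaussian, hL, norm_smul]
  simp [mul_pow, ← Complex.ofReal_pow]

theorem lintegral_enorm_pow_of_norm_adjoint_eq {L : V →L[ℝ] W} {c : ℝ}
    (hL : ∀ w, ‖L.adjoint w‖ = c * ‖w‖) (t : ℕ) :
    ∫⁻ x, ‖L x‖ₑ ^ (2 * t) ∂stdGaussian V =
      ‖c‖ₑ ^ (2 * t) * ∫⁻ w, ‖w‖ₑ ^ (2 * t) ∂stdGaussian W := by
  rw [← lintegral_map (f := fun w : W => ‖w‖ₑ ^ (2 * t)) (by fun_prop) (by fun_prop),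
    map_stdGaussian_of_norm_adjoint_eq hL, lintegral_map (by fun_prop) (by fun_prop),
    ← lintegral_const_mul _ (by fun_prop)]
  simp_rw [enorm_smul, mul_pow]

end Gaussian

section Haar

variable {ι : Type*} [Fintype ι]

theorem exists_orthonormalBasis_norm_smul_eq (i : ι) (x : EuclideanSpace ℂ ι) :
    ∃ b : OrthonormalBasis ι ℂ (EuclideanSpace ℂ ι), ‖x‖ • b i = x := by
  obtain rfl | hx := eq_or_ne x 0
  · exact ⟨EuclideanSpace.basisFun ι ℂ, by simp⟩
  have hunit : Orthonormal ℂ (({i} : Set ι).domRestrict fun _ => ‖x‖⁻¹ • x) :=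
    ⟨fun _ => by simp [norm_smul, hx], fun j k hjk => (hjk (Subsingleton.elim j k)).elim⟩
  obtain ⟨b, hb⟩ := hunit.exists_orthonormalBasis_extension_of_card_eq (by simp)
  exact ⟨b, by rw [hb i rfl, smul_inv_smul₀ (norm_ne_zero_iff.mpr hx)]⟩

variable [DecidableEq ι]

instance : CompactSpace (unitaryGroup ι ℂ) := by
  have hball : IsCompact (Set.univ.pi fun _ : ι => Set.univ.pi fun _ : ι =>
      Metric.closedBall (0 : ℂ) 1) :=
    isCompact_univ_pi fun _ => isCompact_univ_pi fun _ => isCompact_closedBall _ _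
  exact isCompact_iff_compactSpace.mp <|
    IsCompact.of_isClosed_subset (X := Matrix ι ι ℂ) hball isClosed_unitary fun U hU i _ j _ =>
      mem_closedBall_zero_iff.mpr (entry_norm_bound_of_unitary hU i j)

instance : SecondCountableTopology (unitaryGroup ι ℂ) :=
  have : SecondCountableTopology (Matrix ι ι ℂ) :=
    inferInstanceAs (SecondCountableTopology (ι → ι → ℂ))
  TopologicalSpace.Subtype.secondCountableTopology _

noncomputable instance : MeasurableSpace (unitaryGroup ι ℂ) := borel _

instance : BorelSpace (unitaryGroup ι ℂ) := ⟨rfl⟩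

variable (ι) in
/-- The Haar probability measure of the unitary group. -/
noncomputable def unitaryHaar : Measure (unitaryGroup ι ℂ) :=
  Measure.haarMeasure ⊤

instance : IsProbabilityMeasure (unitaryHaar ι) where
  measure_univ := Measure.haarMeasure_self (K₀ := ⊤)

instance : (unitaryHaar ι).IsHaarMeasure := by
  unfold unitaryHaar
  infer_instance

instance : (unitaryHaar ι).IsMulRightInvariant where
  map_mul_right_eq_self U := by
    have := Measure.isProbabilityMeasure_map (μ := unitaryHaar ι) (f := (· * U)) (by fun_prop)
    exact Measure.isHaarMeasure_eq_of_isProbabilityMeasure _ _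

/-- The unitary group, acting on `ℂ^ι` as its group of linear isometries. -/
noncomputable def act : unitaryGroup ι ℂ ≃* (EuclideanSpace ℂ ι ≃ₗᵢ[ℂ] EuclideanSpace ℂ ι) :=
  (Unitary.mapEquiv { toEuclideanCLM (n := ι) (𝕜 := ℂ) with }).toMulEquiv.trans
    Unitary.linearIsometryEquiv

theorem act_apply (U : unitaryGroup ι ℂ) (x : EuclideanSpace ℂ ι) :
    act U x = WithLp.toLp 2 ((U : Matrix ι ι ℂ) *ᵥ x.ofLp) :=
  rfl

theorem continuous_act :
    Continuous fun p : unitaryGroup ι ℂ × EuclideanSpace ℂ ι => act p.1 p.2 := by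
  simp only [act_apply]
  fun_prop

theorem exists_act_eq_of_norm_eq {x y : EuclideanSpace ℂ ι} (h : ‖x‖ = ‖y‖) :
    ∃ U : unitaryGroup ι ℂ, act U x = y := by
  obtain _ | ⟨⟨i⟩⟩ := isEmpty_or_nonempty ι
  · exact ⟨1, Subsingleton.elim _ _⟩
  obtain ⟨b, hb⟩ := exists_orthonormalBasis_norm_smul_eq i x
  obtain ⟨c, hc⟩ := exists_orthonormalBasis_norm_smul_eq i y
  refine ⟨act.symm (b.repr.trans c.repr.symm), ?_⟩
  rw [← hb, ← hc, ← h, map_real_smul (act _) (act _).continuous]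
  simp

variable {h : EuclideanSpace ℂ ι → ℝ≥0∞}

theorem measurable_comp_act (hm : Measurable h) :
    Measurable fun p : EuclideanSpace ℂ ι × unitaryGroup ι ℂ => h (act p.2 p.1) :=
  hm.comp (continuous_act.comp continuous_swap).measurable

theorem lintegral_act_unitaryHaar_eq_of_norm_eq (h : EuclideanSpace ℂ ι → ℝ≥0∞)
    {x y : EuclideanSpace ℂ ι} (hxy : ‖x‖ = ‖y‖) :
    ∫⁻ U, h (act U x) ∂unitaryHaar ι = ∫⁻ U, h (act U y) ∂unitaryHaar ι := by
  obtain ⟨V, rfl⟩ := exists_act_eq_of_norm_eq hxy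
  rw [← lintegral_mul_right_eq_self (fun U => h (act U x)) V]
  simp

theorem lintegral_act_unitaryHaar_of_homogeneous {p : ℕ}
    (hh : ∀ (c : ℝ) x, h (c • x) = ‖c‖ₑ ^ p * h x) (hm : Measurable h)
    (x y : EuclideanSpace ℂ ι) :
    ‖x‖ₑ ^ p * ∫⁻ U, h (act U y) ∂unitaryHaar ι = ‖y‖ₑ ^ p * ∫⁻ U, h (act U x) ∂unitaryHaar ι := by
  have hsmul (c : ℝ) (z : EuclideanSpace ℂ ι) : ∫⁻ U, h (act U (c • z)) ∂unitaryHaar ι =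
      ‖c‖ₑ ^ p * ∫⁻ U, h (act U z) ∂unitaryHaar ι := by
    have hz : Measurable fun U : unitaryGroup ι ℂ => h (act U z) :=
      Measurable.of_uncurry_left (f := fun z U => h (act U z)) (measurable_comp_act hm)
    simp_rw [map_real_smul (act _) (act _).continuous, hh]
    exact lintegral_const_mul _ hz
  have hnorm := lintegral_act_unitaryHaar_eq_of_norm_eq h (x := ‖x‖ • y) (y := ‖y‖ • x)
    (by simp [norm_smul, mul_comm])
  simpa [hsmul] using hnorm

theorem map_act_stdGaussian (U : unitaryGroup ι ℂ) :
    (stdGaussian (EuclideanSpace ℂ ι)).map (act U) = stdGaussian (EuclideanSpace ℂ ι) :=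
  stdGaussian_map { (act U).toLinearEquiv.restrictScalars ℝ with norm_map' := (act U).norm_map }

theorem lintegral_lintegral_act_stdGaussian (hm : Measurable h) :
    ∫⁻ x, ∫⁻ U, h (act U x) ∂unitaryHaar ι ∂stdGaussian (EuclideanSpace ℂ ι) =
      ∫⁻ x, h x ∂stdGaussian (EuclideanSpace ℂ ι) := by
  have hinv (U : unitaryGroup ι ℂ) : ∫⁻ x, h (act U x) ∂stdGaussian (EuclideanSpace ℂ ι) =
      ∫⁻ x, h x ∂stdGaussian (EuclideanSpace ℂ ι) := by
    rw [← lintegral_map hm (act U).continuous.measurable, map_act_stdGaussian]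
  rw [lintegral_lintegral_swap (measurable_comp_act hm).aemeasurable]
  simp [hinv]

theorem lintegral_act_unitaryHaar_mul {p : ℕ}
    (hh : ∀ (c : ℝ) x, h (c • x) = ‖c‖ₑ ^ p * h x) (hm : Measurable h) (y : EuclideanSpace ℂ ι) :
    (∫⁻ U, h (act U y) ∂unitaryHaar ι) * ∫⁻ x, ‖x‖ₑ ^ p ∂stdGaussian (EuclideanSpace ℂ ι) =
      ‖y‖ₑ ^ p * ∫⁻ x, h x ∂stdGaussian (EuclideanSpace ℂ ι) := by
  rw [mul_comm, ← lintegral_mul_const _ (by fun_prop), ← lintegral_lintegral_act_stdGaussian hm,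
    ← lintegral_const_mul _ (measurable_comp_act hm).lintegral_prod_right']
  exact lintegral_congr fun x => lintegral_act_unitaryHaar_of_homogeneous hh hm x y

end Haar

section ComplexMoments

variable {α β ι κ : Type*} [Fintype α] [Fintype β] [Fintype ι] [Fintype κ]

theorem prod_range_two_mul_add_two_mul (N t : ℕ) :
    ∏ i ∈ Finset.range t, (2 * N + 2 * i) = 2 ^ t * N.ascFactorial t := by
  simp_rw [← mul_add, Finset.prod_mul_distrib, Nat.ascFactorial_eq_prod_range]
  simp

theorem lintegral_enorm_pow_stdGaussian_euclideanSpace (ι : Type*) [Fintype ι] [Nonempty ι]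
    (t : ℕ) : ∫⁻ x, ‖x‖ₑ ^ (2 * t) ∂stdGaussian (EuclideanSpace ℂ ι) =
      2 ^ t * (Fintype.card ι).ascFactorial t := by
  have hrank : finrank ℝ (EuclideanSpace ℂ ι) = 2 * Fintype.card ι := by
    simpa using finrank_real_of_complex (EuclideanSpace ℂ ι)
  rw [lintegral_enorm_pow_stdGaussian, hrank, prod_range_two_mul_add_two_mul]
  push_cast
  rfl

theorem real_inner_eq_re_inner_euclideanSpace (x y : EuclideanSpace ℂ ι) :
    inner ℝ x y = (inner ℂ x y).re := by
  simp [PiLp.inner_apply, Complex.inner]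

theorem adjoint_restrictScalars (L : EuclideanSpace ℂ ι →L[ℂ] EuclideanSpace ℂ κ)
    (w : EuclideanSpace ℂ κ) : (L.restrictScalars ℝ).adjoint w = L.adjoint w :=
  ext_inner_right ℝ fun x => by
    rw [ContinuousLinearMap.adjoint_inner_left, ContinuousLinearMap.coe_restrictScalars',
      real_inner_eq_re_inner_euclideanSpace, real_inner_eq_re_inner_euclideanSpace,
      ContinuousLinearMap.adjoint_inner_left]

theorem norm_adjoint_innerSL_restrictScalars (u : EuclideanSpace ℂ ι) (z : ℂ) :
    ‖((innerSL ℂ u).restrictScalars ℝ).adjoint z‖ = ‖u‖ * ‖z‖ := by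
  have hadj : ((innerSL ℂ u).restrictScalars ℝ).adjoint z = z • u :=
    ext_inner_right ℝ fun x => by
      rw [ContinuousLinearMap.adjoint_inner_left, real_inner_eq_re_inner_euclideanSpace,
        inner_smul_left]
      simp [Complex.inner, mul_comm]
  rw [hadj, norm_smul, mul_comm]

theorem lintegral_enorm_inner_pow_stdGaussian (u : EuclideanSpace ℂ ι) (t : ℕ) :
    ∫⁻ x, ‖inner ℂ u x‖ₑ ^ (2 * t) ∂stdGaussian (EuclideanSpace ℂ ι) =
      ‖u‖ₑ ^ (2 * t) * (2 ^ t * t.factorial) := by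
  have h := lintegral_enorm_pow_of_norm_adjoint_eq (norm_adjoint_innerSL_restrictScalars u) t
  have hrank : finrank ℝ ℂ = 2 * 1 := Complex.finrank_real_complex
  rw [lintegral_enorm_pow_stdGaussian, hrank, prod_range_two_mul_add_two_mul,
    Nat.one_ascFactorial] at h
  simpa using h

theorem exists_norm_le_one_norm_apply_eq {E F : Type*} [NormedAddCommGroup E] [NormedSpace ℂ E]
    [FiniteDimensional ℂ E] [NormedAddCommGroup F] [NormedSpace ℂ F] (A : E →L[ℂ] F) :
    ∃ x, ‖x‖ ≤ 1 ∧ ‖A x‖ = ‖A‖ := by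
  have := FiniteDimensional.proper ℂ E
  obtain ⟨x, hx, hmax⟩ := (isCompact_closedBall (0 : E) 1).exists_isMaxOn
    ⟨0, by simp⟩ A.continuous.norm.continuousOn
  have hx1 : ‖x‖ ≤ 1 := by simpa using hx
  refine ⟨x, hx1, (A.unit_le_opNorm x hx1).antisymm ?_⟩
  rw [← A.sSup_unitClosedBall_eq_norm]
  refine csSup_le ((Metric.nonempty_closedBall.mpr zero_le_one).image _) ?_
  rintro _ ⟨y, hy, rfl⟩
  exact hmax hy

theorem enorm_pow_mul_factorial_le_lintegral {F : Type*} [NormedAddCommGroup F]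
    [InnerProductSpace ℂ F] [FiniteDimensional ℂ F] (A : EuclideanSpace ℂ ι →L[ℂ] F) (t : ℕ) :
    ‖A‖ₑ ^ (2 * t) * (2 ^ t * t.factorial) ≤
      ∫⁻ y, ‖A y‖ₑ ^ (2 * t) ∂stdGaussian (EuclideanSpace ℂ ι) := by
  obtain ⟨w, hw, hAw⟩ := exists_norm_le_one_norm_apply_eq A.adjoint
  have hnorm : ‖A.adjoint w‖ = ‖A‖ := by rw [hAw, LinearIsometryEquiv.norm_map]
  rw [← enorm_norm A, ← hnorm, enorm_norm, ← lintegral_enorm_inner_pow_stdGaussian]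
  gcongr with y
  rw [ContinuousLinearMap.adjoint_inner_left, enorm_le_iff_norm_le]
  calc ‖inner ℂ w (A y)‖ ≤ ‖w‖ * ‖A y‖ := norm_inner_le_norm _ _
    _ ≤ ‖A y‖ := mul_le_of_le_one_left (norm_nonneg _) hw

end ComplexMoments

section CoefficientMatrices

open scoped Matrix.Norms.L2Operator

variable {α β : Type*}

/-- The coefficient matrix `(x_{ab})_{b,a}` of a vector `x` of `ℂ^α ⊗ ℂ^β`. The state of the second
factor of a pure state `x` is `coeffMatrix x * (coeffMatrix x)ᴴ`. -/
def coeffMatrix : EuclideanSpace ℂ (α × β) →ₗ[ℂ] Matrix β α ℂ where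
  toFun x := of fun b a => x (a, b)
  map_add' _ _ := rfl
  map_smul' _ _ := rfl

variable [Fintype α] [Fintype β]

theorem norm_toLp_star_mul (y : EuclideanSpace ℂ α) (w : EuclideanSpace ℂ β) :
    ‖(WithLp.toLp 2 fun p : α × β => star (y p.1) * w p.2 : EuclideanSpace ℂ (α × β))‖ =
      ‖y‖ * ‖w‖ := by
  simp only [EuclideanSpace.norm_eq, norm_mul, norm_star, mul_pow, Fintype.sum_prod_type,
    ← Finset.mul_sum, ← Finset.sum_mul]
  exact Real.sqrt_mul (by positivity) _

variable [DecidableEq α]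

/-- The contraction of the first factor of `ℂ^α ⊗ ℂ^β` against a vector `y` of `ℂ^α`, without
conjugation of `y`: the vector `coeffMatrix x * y` as a linear function of `x`. -/
noncomputable def contractLeft (y : EuclideanSpace ℂ α) :
    EuclideanSpace ℂ (α × β) →L[ℂ] EuclideanSpace ℂ β :=
  LinearMap.toContinuousLinearMap <|
    LinearMap.applyₗ y ∘ₗ (toEuclideanLin (𝕜 := ℂ)).toLinearMap ∘ₗ coeffMatrix

theorem contractLeft_apply (y : EuclideanSpace ℂ α) (x : EuclideanSpace ℂ (α × β)) (b : β) :
    contractLeft y x b = ∑ a, x (a, b) * y a :=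
  rfl

theorem continuous_contractLeft : Continuous
    fun p : EuclideanSpace ℂ (α × β) × EuclideanSpace ℂ α => contractLeft p.2 p.1 := by
  refine PiLp.continuous_toLp 2 _ |>.comp <| continuous_pi fun b => ?_
  change Continuous fun p : EuclideanSpace ℂ (α × β) × EuclideanSpace ℂ α => ∑ a, p.1 (a, b) * p.2 a
  fun_prop

theorem norm_adjoint_contractLeft (y : EuclideanSpace ℂ α) (w : EuclideanSpace ℂ β) :
    ‖(contractLeft y).adjoint w‖ = ‖y‖ * ‖w‖ := by
  rw [← norm_toLp_star_mul]
  congr 1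
  refine ext_inner_right ℂ fun x => ?_
  rw [ContinuousLinearMap.adjoint_inner_left]
  simp only [PiLp.inner_apply, contractLeft_apply, RCLike.inner_apply, Fintype.sum_prod_type_right,
    Finset.sum_mul, map_mul, starRingEnd_apply, star_star]
  exact Finset.sum_congr rfl fun b _ => Finset.sum_congr rfl fun a _ => by ring

theorem norm_coeffMatrix_le (x : EuclideanSpace ℂ (α × β)) : ‖coeffMatrix x‖ ≤ ‖x‖ := by
  refine ContinuousLinearMap.opNorm_le_bound _ (norm_nonneg x) fun y => ?_
  have hy : ‖contractLeft (β := β) y‖ ≤ ‖y‖ := by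
    rw [← LinearIsometryEquiv.norm_map ContinuousLinearMap.adjoint]
    exact ContinuousLinearMap.opNorm_le_bound _ (norm_nonneg y)
      fun w => (norm_adjoint_contractLeft y w).le
  calc ‖contractLeft y x‖ ≤ ‖y‖ * ‖x‖ := ContinuousLinearMap.le_of_opNorm_le _ hy x
    _ = ‖x‖ * ‖y‖ := mul_comm _ _

/-- The `2t`-th moment of `‖coeffMatrix x * y‖` for a standard Gaussian vector `y`. -/
noncomputable def contractionMoment (t : ℕ) (x : EuclideanSpace ℂ (α × β)) : ℝ≥0∞ :=
  ∫⁻ y, ‖contractLeft y x‖ₑ ^ (2 * t) ∂stdGaussian (EuclideanSpace ℂ α)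

theorem measurable_enorm_contractLeft_pow (t : ℕ) : Measurable
    fun p : EuclideanSpace ℂ (α × β) × EuclideanSpace ℂ α => ‖contractLeft p.2 p.1‖ₑ ^ (2 * t) :=
  (continuous_contractLeft (α := α) (β := β)).enorm.measurable.pow_const _

theorem measurable_contractionMoment (t : ℕ) :
    Measurable (contractionMoment t : EuclideanSpace ℂ (α × β) → ℝ≥0∞) :=
  (measurable_enorm_contractLeft_pow t).lintegral_prod_right'

theorem contractionMoment_smul (t : ℕ) (c : ℝ) (x : EuclideanSpace ℂ (α × β)) :
    contractionMoment t (c • x) = ‖c‖ₑ ^ (2 * t) * contractionMoment t x := by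
  unfold contractionMoment
  have hx : Measurable fun y => ‖contractLeft y x‖ₑ ^ (2 * t) :=
    Measurable.of_uncurry_left (f := fun x y => ‖contractLeft y x‖ₑ ^ (2 * t))
      (measurable_enorm_contractLeft_pow t)
  simp_rw [map_real_smul (contractLeft _) (contractLeft _).continuous, enorm_smul, mul_pow]
  exact lintegral_const_mul _ hx

theorem enorm_coeffMatrix_pow_mul_le (t : ℕ) (x : EuclideanSpace ℂ (α × β)) :
    ‖coeffMatrix x‖ₑ ^ (2 * t) * (2 ^ t * t.factorial) ≤ contractionMoment t x :=
  enorm_pow_mul_factorial_le_lintegral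
    (LinearMap.toContinuousLinearMap (toEuclideanLin (coeffMatrix x))) t

theorem lintegral_contractionMoment [Nonempty α] [Nonempty β] (t : ℕ) :
    ∫⁻ x, contractionMoment t x ∂stdGaussian (EuclideanSpace ℂ (α × β)) =
      2 ^ t * (Fintype.card α).ascFactorial t * (2 ^ t * (Fintype.card β).ascFactorial t) := by
  have hinner (y : EuclideanSpace ℂ α) :
      ∫⁻ x, ‖contractLeft (β := β) y x‖ₑ ^ (2 * t) ∂stdGaussian (EuclideanSpace ℂ (α × β)) =
        ‖y‖ₑ ^ (2 * t) * (2 ^ t * (Fintype.card β).ascFactorial t) := by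
    have hL (w : EuclideanSpace ℂ β) :
        ‖((contractLeft (β := β) y).restrictScalars ℝ).adjoint w‖ = ‖y‖ * ‖w‖ := by
      rw [adjoint_restrictScalars, norm_adjoint_contractLeft]
    have h := lintegral_enorm_pow_of_norm_adjoint_eq hL t
    rw [enorm_norm, lintegral_enorm_pow_stdGaussian_euclideanSpace] at h
    exact h
  simp_rw [contractionMoment]
  rw [lintegral_lintegral_swap (measurable_enorm_contractLeft_pow t).aemeasurable]
  simp_rw [hinner]
  rw [lintegral_mul_const _ (by fun_prop), lintegral_enorm_pow_stdGaussian_euclideanSpace]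

variable [DecidableEq β]

theorem lintegral_enorm_coeffMatrix_act_pow_mul_le [Nonempty α] [Nonempty β] (t : ℕ)
    (x : EuclideanSpace ℂ (α × β)) :
    (∫⁻ U, ‖coeffMatrix (act U x)‖ₑ ^ (2 * t) ∂unitaryHaar (α × β)) *
        (t.factorial * (Fintype.card α * Fintype.card β).ascFactorial t) ≤
      ‖x‖ₑ ^ (2 * t) * ((Fintype.card α).ascFactorial t * (Fintype.card β).ascFactorial t) := by
  have hmean := lintegral_act_unitaryHaar_mul (contractionMoment_smul t)
    (measurable_contractionMoment t) x
  rw [lintegral_contractionMoment, lintegral_enorm_pow_stdGaussian_euclideanSpace,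
    Fintype.card_prod] at hmean
  have hle := lintegral_mono (μ := unitaryHaar (α × β)) fun U =>
    enorm_coeffMatrix_pow_mul_le t (act U x)
  rw [lintegral_mul_const' _ _ (by finiteness)] at hle
  have hpow : (2 ^ t * 2 ^ t : ℝ≥0∞) ≠ 0 := by positivity
  refine (ENNReal.mul_le_mul_iff_right hpow (by finiteness)).mp ?_
  calc _ = (∫⁻ U, ‖coeffMatrix (act U x)‖ₑ ^ (2 * t) ∂unitaryHaar (α × β)) *
        (2 ^ t * t.factorial) * (2 ^ t * (Fintype.card α * Fintype.card β).ascFactorial t) := by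
        ring
    _ ≤ _ := mul_le_mul_left hle _
    _ = _ := by rw [hmean]; ring

end CoefficientMatrices

section ReducedState

open scoped Matrix.Norms.L2Operator

variable {α α₁ β ι κ : Type*} [Fintype α] [Fintype α₁] [DecidableEq α₁]

theorem isIsometry_one_submatrix [DecidableEq ι] [Fintype κ] [DecidableEq κ] (e : ι ↪ κ) :
    IsIsometry ((1 : Matrix κ κ ℂ).submatrix id e) := by
  rw [IsIsometry, conjTranspose_submatrix, conjTranspose_one,
    ← submatrix_mul _ _ e id e Function.bijective_id, mul_one, submatrix_one e e.injective]

theorem IsIsometry.unitary_mul [DecidableEq ι] [Fintype κ] [DecidableEq κ] {V : Matrix κ ι ℂ}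
    (hV : IsIsometry V) (U : unitaryGroup κ ℂ) : IsIsometry ((U : Matrix κ κ ℂ) * V) := by
  have hU : (U : Matrix κ κ ℂ)ᴴ * (U : Matrix κ κ ℂ) = 1 := mem_unitaryGroup_iff'.mp U.2
  rw [IsIsometry, conjTranspose_mul, Matrix.mul_assoc, ← Matrix.mul_assoc _ _ V, hU,
    Matrix.one_mul, hV]

variable [Fintype ι]

theorem one_kronecker_mulVec (U : Matrix κ ι ℂ) (v : α₁ × ι → ℂ) (i : α₁) (p : κ) :
    (((1 : Matrix α₁ α₁ ℂ) ⊗ₖ U) *ᵥ v) (i, p) = (U *ᵥ fun j => v (i, j)) p := by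
  simp [mulVec, dotProduct, Fintype.sum_prod_type, one_apply]

theorem reducedState_eq_sum (U : Matrix (α × β) ι ℂ) (ψ : EuclideanSpace ℂ (α₁ × ι)) :
    reducedState U ψ = ∑ i, coeffMatrix (WithLp.toLp 2 (U *ᵥ fun j => ψ (i, j))) *
      (coeffMatrix (WithLp.toLp 2 (U *ᵥ fun j => ψ (i, j))))ᴴ := by
  ext b b'
  simp only [reducedState, traceLeft, ketBra, mul_vecMulVec, vecMulVec_mul, of_apply,
    vecMulVec_apply]
  simp only [Matrix.sum_apply, mul_apply, conjTranspose_apply]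
  rw [Finset.sum_comm]
  refine Finset.sum_congr rfl fun i _ => Finset.sum_congr rfl fun a _ => ?_
  have hstar := congrFun (star_mulVec ((1 : Matrix α₁ α₁ ℂ) ⊗ₖ U) ψ.ofLp) (i, a, b')
  rw [Pi.star_apply, one_kronecker_mulVec] at hstar
  exact congrArg₂ (· * ·) (one_kronecker_mulVec U ψ.ofLp i (a, b)) hstar.symm

theorem opNorm_reducedState_le [DecidableEq α] [Fintype β] [DecidableEq β]
    (U : Matrix (α × β) ι ℂ) (ψ : EuclideanSpace ℂ (α₁ × ι)) :
    opNorm (reducedState U ψ) ≤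
      ∑ i, ‖coeffMatrix (α := α) (β := β) (WithLp.toLp 2 (U *ᵥ fun j => ψ (i, j)))‖ ^ 2 := by
  rw [opNorm, ← cstar_norm_def, reducedState_eq_sum]
  refine (norm_sum_le _ _).trans_eq (Finset.sum_congr rfl fun i _ => ?_)
  simpa only [conjTranspose_conjTranspose, l2_opNorm_conjTranspose, ← sq] using
    l2_opNorm_conjTranspose_mul_self (coeffMatrix (WithLp.toLp 2 (U *ᵥ fun j => ψ (i, j))))ᴴ

theorem IsIsometry.norm_mulVec [DecidableEq ι] [Fintype κ] {V : Matrix κ ι ℂ} (hV : IsIsometry V)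
    (v : ι → ℂ) : ‖(WithLp.toLp 2 (V *ᵥ v) : EuclideanSpace ℂ κ)‖ =
      ‖(WithLp.toLp 2 v : EuclideanSpace ℂ ι)‖ := by
  have hinner : inner ℂ (WithLp.toLp 2 (V *ᵥ v) : EuclideanSpace ℂ κ) (WithLp.toLp 2 (V *ᵥ v)) =
      inner ℂ (WithLp.toLp 2 v : EuclideanSpace ℂ ι) (WithLp.toLp 2 v) := by
    rw [EuclideanSpace.inner_toLp_toLp, EuclideanSpace.inner_toLp_toLp, dotProduct_comm,
      star_mulVec, dotProduct_mulVec, vecMul_vecMul, hV, vecMul_one, dotProduct_comm]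
  rw [@norm_eq_sqrt_re_inner ℂ, hinner, ← @norm_eq_sqrt_re_inner ℂ]

end ReducedState

section Net

open Metric
open scoped NNReal

variable {E : Type*} [NormedAddCommGroup E] [NormedSpace ℝ E] [FiniteDimensional ℝ E]
  {A : Set E} {δ : ℝ≥0}

theorem card_le_of_isSeparated (hδ : 0 < δ) {N : Finset E} (hN : (N : Set E) ⊆ closedBall 0 1)
    (hsep : IsSeparated δ (N : Set E)) : (N.card : ℝ) ≤ (1 + 2 / δ) ^ finrank ℝ E := by
  borelize E
  let μ : Measure E := Measure.addHaar
  have hδ2 : (0 : ℝ) < δ / 2 := by positivity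
  have hdisj : (N : Set E).PairwiseDisjoint fun x => ball x (δ / 2 : ℝ) := fun x hx y hy hxy => by
    refine ball_disjoint_ball ?_
    have hlt : (δ : ℝ≥0∞) < edist x y := hsep hx hy hxy
    rw [edist_nndist, ENNReal.coe_lt_coe, ← NNReal.coe_lt_coe, coe_nndist] at hlt
    linarith
  have hsub : ⋃ x ∈ N, ball x (δ / 2 : ℝ) ⊆ ball (0 : E) (1 + δ / 2) :=
    Set.iUnion₂_subset fun x hx => ball_subset_ball' <| by
      linarith [mem_closedBall.mp (hN hx)]
  have hvol : N.card * ENNReal.ofReal ((δ / 2 : ℝ) ^ finrank ℝ E) * μ (ball 0 1) ≤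
      ENNReal.ofReal ((1 + δ / 2 : ℝ) ^ finrank ℝ E) * μ (ball 0 1) := by
    rw [← μ.addHaar_ball_of_pos 0 (by positivity : (0 : ℝ) < 1 + δ / 2)]
    refine le_of_eq_of_le ?_ (measure_mono hsub)
    rw [measure_biUnion_finset hdisj fun _ _ => measurableSet_ball]
    simp [μ.addHaar_ball_of_pos _ hδ2, mul_assoc]
  have hcard : N.card * (δ / 2 : ℝ) ^ finrank ℝ E ≤ (1 + δ / 2 : ℝ) ^ finrank ℝ E := by
    rw [ENNReal.mul_le_mul_iff_left (measure_ball_pos _ _ zero_lt_one).ne' measure_ball_lt_top.ne,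
      ← ENNReal.ofReal_natCast, ← ENNReal.ofReal_mul (by positivity)] at hvol
    exact (ENNReal.ofReal_le_ofReal_iff (by positivity)).mp hvol
  calc (N.card : ℝ) ≤ (1 + δ / 2 : ℝ) ^ finrank ℝ E / (δ / 2 : ℝ) ^ finrank ℝ E :=
        (le_div_iff₀ (by positivity)).mpr hcard
    _ = (1 + 2 / δ) ^ finrank ℝ E := by
        rw [← div_pow]
        field_simp
        ring

theorem packingNumber_le (hδ : 0 < δ) (hA : A ⊆ closedBall 0 1) :
    packingNumber δ A ≤ ⌊(1 + 2 / δ : ℝ) ^ finrank ℝ E⌋₊ := by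
  refine iSup₂_le fun C hC => iSup_le fun hsep => ?_
  by_contra! hlt
  obtain ⟨N, hNC, hN⟩ := Set.exists_subset_encard_eq (Order.add_one_le_of_lt hlt)
  have hfin : N.Finite := Set.finite_of_encard_eq_coe hN
  lift N to Finset E using hfin
  have hcard := Nat.le_floor <| card_le_of_isSeparated hδ (hNC.trans (hC.trans hA))
    (hsep.subset hNC)
  rw [Set.encard_coe_eq_coe_finsetCard, ← Nat.cast_add_one, Nat.cast_inj] at hN
  omega

theorem exists_finset_isCover (hδ : 0 < δ) (hA : A ⊆ closedBall 0 1) :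
    ∃ N : Finset E, (N : Set E) ⊆ A ∧ IsCover δ A N ∧
      (N.card : ℝ) ≤ (1 + 2 / δ) ^ finrank ℝ E := by
  have hpack := packingNumber_le hδ hA
  have htop : packingNumber δ A ≠ ⊤ := ne_top_of_le_ne_top (ENat.natCast_ne_top _) hpack
  have hfin : (maximalSeparatedSet δ A).Finite :=
    Set.encard_ne_top_iff.mp (encard_maximalSeparatedSet htop ▸ htop)
  have hsub : (hfin.toFinset : Set E) ⊆ A := by
    simpa using maximalSeparatedSet_subset
  refine ⟨hfin.toFinset, hsub, by simpa using isCover_maximalSeparatedSet htop, ?_⟩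
  exact card_le_of_isSeparated hδ (hsub.trans hA) (by simpa using isSeparated_maximalSeparatedSet)

end Net

section Selection

variable {Ω I : Type*} [MeasurableSpace Ω] {μ : Measure Ω} [IsProbabilityMeasure μ]

-- The factors are chosen one after the other, each with at most the average increase.
theorem exists_sum_prod_le {s : Finset I} {f : I → Ω → ℝ≥0∞} {C : ℝ≥0∞}
    (hf : ∀ i ∈ s, Measurable (f i)) (hC : ∀ i ∈ s, ∫⁻ ω, f i ω ∂μ ≤ C) (n : ℕ) :
    ∃ ω : Fin n → Ω, ∑ i ∈ s, ∏ k, f i (ω k) ≤ s.card * C ^ n := by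
  induction n with
  | zero => exact ⟨Fin.elim0, by simp⟩
  | succ n ih =>
    obtain ⟨ω, hω⟩ := ih
    have hm (i) (hi : i ∈ s) : Measurable fun w => (∏ k, f i (ω k)) * f i w := (hf i hi).const_mul _
    obtain ⟨w, hw⟩ := exists_le_lintegral (μ := μ) (Finset.measurable_fun_sum s hm).aemeasurable
    refine ⟨Fin.snoc ω w, ?_⟩
    simp only [Fin.prod_univ_castSucc, Fin.snoc_castSucc, Fin.snoc_last]
    calc ∑ i ∈ s, (∏ k, f i (ω k)) * f i w
        ≤ ∑ i ∈ s, ∫⁻ w, (∏ k, f i (ω k)) * f i w ∂μ := by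
          rwa [← lintegral_finsetSum' s fun i hi => (hm i hi).aemeasurable]
      _ ≤ ∑ i ∈ s, (∏ k, f i (ω k)) * C := by
          gcongr with i hi
          rw [lintegral_const_mul _ (hf i hi)]
          gcongr
          exact hC i hi
      _ ≤ s.card * C ^ n * C := by rw [← Finset.sum_mul]; gcongr
      _ = s.card * C ^ (n + 1) := by rw [mul_assoc, pow_succ]

theorem exp_le_one_add_two_mul {x : ℝ} (h0 : 0 ≤ x) (h1 : x ≤ 1) : Real.exp x ≤ 1 + 2 * x := by
  have h := le_of_abs_le (Real.abs_exp_sub_one_sub_id_le (abs_le.mpr ⟨by linarith, h1⟩))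
  nlinarith

theorem lintegral_ofReal_exp_le {g : Ω → ℝ} {p : ℝ} (hg : Measurable g) (hg0 : ∀ ω, 0 ≤ g ω)
    (hg1 : ∀ ω, g ω ≤ 1) (hp : 0 ≤ p) (hmean : ∫⁻ ω, ENNReal.ofReal (g ω) ∂μ ≤ ENNReal.ofReal p) :
    ∫⁻ ω, ENNReal.ofReal (Real.exp (g ω)) ∂μ ≤ ENNReal.ofReal (1 + 2 * p) := by
  have hofReal {y : ℝ} (hy : 0 ≤ y) : ENNReal.ofReal (1 + 2 * y) = 1 + 2 * ENNReal.ofReal y := by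
    rw [ENNReal.ofReal_add zero_le_one (by positivity), ENNReal.ofReal_mul zero_le_two]
    simp
  calc ∫⁻ ω, ENNReal.ofReal (Real.exp (g ω)) ∂μ
      ≤ ∫⁻ ω, (1 + 2 * ENNReal.ofReal (g ω)) ∂μ := by
        gcongr with ω
        rw [← hofReal (hg0 ω)]
        exact ENNReal.ofReal_le_ofReal (exp_le_one_add_two_mul (hg0 ω) (hg1 ω))
    _ = 1 + 2 * ∫⁻ ω, ENNReal.ofReal (g ω) ∂μ := by
        rw [lintegral_add_left measurable_const, lintegral_const_mul _ hg.ennreal_ofReal]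
        simp
    _ ≤ ENNReal.ofReal (1 + 2 * p) := by
        rw [hofReal hp]
        gcongr

theorem exists_forall_sum_le_log_card_add {s : Finset I} {g : I → Ω → ℝ} {p : ℝ}
    (hg : ∀ i ∈ s, Measurable (g i)) (hg0 : ∀ i ∈ s, ∀ ω, 0 ≤ g i ω)
    (hg1 : ∀ i ∈ s, ∀ ω, g i ω ≤ 1) (hp : 0 ≤ p)
    (hmean : ∀ i ∈ s, ∫⁻ ω, ENNReal.ofReal (g i ω) ∂μ ≤ ENNReal.ofReal p) (n : ℕ) :
    ∃ ω : Fin n → Ω, ∀ i ∈ s, ∑ k, g i (ω k) ≤ Real.log s.card + 2 * p * n := by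
  obtain ⟨ω, hω⟩ := exists_sum_prod_le (fun i hi => (hg i hi).exp.ennreal_ofReal)
    (fun i hi => lintegral_ofReal_exp_le (hg i hi) (hg0 i hi) (hg1 i hi) hp (hmean i hi)) n
  refine ⟨ω, fun i hi => ?_⟩
  have hs : (0 : ℝ) < s.card := by exact_mod_cast Finset.card_pos.mpr ⟨i, hi⟩
  have hi' := (Finset.single_le_sum (fun _ _ => zero_le) hi).trans hω
  rw [← ENNReal.ofReal_prod_of_nonneg fun k _ => (Real.exp_pos _).le, ← Real.exp_sum,
    ← ENNReal.ofReal_natCast, ← ENNReal.ofReal_pow (by positivity),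
    ← ENNReal.ofReal_mul (by positivity), ENNReal.ofReal_le_ofReal_iff (by positivity)] at hi'
  rw [← Real.exp_le_exp, Real.exp_add, Real.exp_log hs]
  calc Real.exp (∑ k, g i (ω k)) ≤ s.card * (1 + 2 * p) ^ n := hi'
    _ ≤ s.card * Real.exp (2 * p) ^ n := by
        gcongr
        linarith [Real.add_one_le_exp (2 * p)]
    _ = s.card * Real.exp (2 * p * n) := by rw [mul_comm (2 * p), Real.exp_nat_mul]

end Selection

section Excess

open scoped Matrix.Norms.L2Operator

variable {α β : Type*} [Fintype α] [DecidableEq α] [Fintype β]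

/-- The amount by which the largest Schmidt weight `‖coeffMatrix x‖²` of `x` exceeds its allowance
`c ‖x‖²`. -/
noncomputable def excess (c : ℝ) (x : EuclideanSpace ℂ (α × β)) : ℝ :=
  max 0 (‖coeffMatrix x‖ ^ 2 - c * ‖x‖ ^ 2)

variable {c : ℝ} {x y : EuclideanSpace ℂ (α × β)}

theorem excess_nonneg : 0 ≤ excess c x :=
  le_max_left _ _

theorem sq_norm_coeffMatrix_le_add_excess (c : ℝ) (x : EuclideanSpace ℂ (α × β)) :
    ‖coeffMatrix x‖ ^ 2 ≤ c * ‖x‖ ^ 2 + excess c x :=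
  sub_le_iff_le_add'.mp (le_max_right _ _)

theorem excess_smul (c r : ℝ) (x : EuclideanSpace ℂ (α × β)) :
    excess c (r • x) = r ^ 2 * excess c x := by
  have hr : coeffMatrix (r • x) = r • coeffMatrix x := coeffMatrix.map_smul_of_tower r x
  rw [excess, excess, mul_max_of_nonneg _ _ (sq_nonneg r), hr, norm_smul, norm_smul,
    mul_pow, mul_pow, Real.norm_eq_abs, sq_abs]
  ring_nf

theorem excess_le_sq_norm (hc : 0 ≤ c) : excess c x ≤ ‖x‖ ^ 2 :=
  max_le (sq_nonneg _) <| (sub_le_self _ (by positivity)).trans <|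
    pow_le_pow_left₀ (norm_nonneg _) (norm_coeffMatrix_le x) 2

theorem excess_le_excess_add (hx : ‖x‖ = 1) (hy : ‖y‖ = 1) :
    excess c x ≤ excess c y + 2 * ‖x - y‖ := by
  have hnx : ‖coeffMatrix x‖ ≤ 1 := hx ▸ norm_coeffMatrix_le x
  have hny : ‖coeffMatrix y‖ ≤ 1 := hy ▸ norm_coeffMatrix_le y
  have hdiff : ‖coeffMatrix x‖ - ‖coeffMatrix y‖ ≤ ‖x - y‖ :=
    (norm_sub_norm_le _ _).trans (map_sub coeffMatrix x y ▸ norm_coeffMatrix_le (x - y))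
  have hle := sq_norm_coeffMatrix_le_add_excess c y
  rw [hy] at hle
  refine max_le (add_nonneg excess_nonneg (by positivity)) ?_
  rw [hx]
  nlinarith [norm_nonneg (coeffMatrix x), norm_nonneg (coeffMatrix y), norm_nonneg (x - y)]

theorem continuous_excess (c : ℝ) :
    Continuous (excess c : EuclideanSpace ℂ (α × β) → ℝ) := by
  have hcont : Continuous (coeffMatrix : EuclideanSpace ℂ (α × β) → Matrix β α ℂ) :=
    coeffMatrix.continuous_of_finiteDimensional
  unfold excess
  fun_prop

theorem pow_mul_excess_le (hc : 0 < c) (hx : ‖x‖ = 1) (t : ℕ) :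
    c ^ t * excess c x ≤ ‖coeffMatrix x‖ ^ (2 * t) := by
  rw [excess, hx, one_pow, mul_one, pow_mul]
  obtain hle | hle := le_total (‖coeffMatrix x‖ ^ 2) c
  · rw [max_eq_left (by linarith), mul_zero]
    positivity
  · refine (mul_le_of_le_one_right (by positivity) (max_le zero_le_one ?_)).trans (by gcongr)
    have : ‖coeffMatrix x‖ ^ 2 ≤ 1 := pow_le_one₀ (norm_nonneg _) (hx ▸ norm_coeffMatrix_le x)
    linarith

end Excess

section RandomUnitaries

open scoped Matrix.Norms.L2Operator NNReal

variable {α β : Type*} [Fintype α] [DecidableEq α] [Fintype β] [DecidableEq β] {c : ℝ}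

theorem ascFactorial_pos_of_pos {m : ℕ} (hm : 0 < m) (t : ℕ) : 0 < m.ascFactorial t := by
  obtain ⟨k, rfl⟩ := Nat.exists_eq_add_one.mpr hm
  exact Nat.ascFactorial_pos k t

theorem lintegral_excess_act_le [Nonempty α] [Nonempty β] (hc : 0 < c) {p : ℝ} (t : ℕ)
    (ht : ((Fintype.card α).ascFactorial t * (Fintype.card β).ascFactorial t : ℝ) ≤
      p * (c ^ t * (t.factorial * (Fintype.card α * Fintype.card β).ascFactorial t)))
    {x : EuclideanSpace ℂ (α × β)} (hx : ‖x‖ = 1) :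
    ∫⁻ U, ENNReal.ofReal (excess c (act U x)) ∂unitaryHaar (α × β) ≤ ENNReal.ofReal p := by
  let D : ℕ := t.factorial * (Fintype.card α * Fintype.card β).ascFactorial t
  have hD : 0 < D := Nat.mul_pos t.factorial_pos <|
    ascFactorial_pos_of_pos (Nat.mul_pos Fintype.card_pos Fintype.card_pos) t
  have : (0 : ℝ) < D := by exact_mod_cast hD
  have hpow (U) : ENNReal.ofReal (c ^ t) * ENNReal.ofReal (excess c (act U x)) ≤
      ‖coeffMatrix (act U x)‖ₑ ^ (2 * t) := by
    rw [← ENNReal.ofReal_mul (by positivity), ← ofReal_norm, ← ENNReal.ofReal_pow (norm_nonneg _)]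
    exact ENNReal.ofReal_le_ofReal <|
      pow_mul_excess_le hc (by rw [LinearIsometryEquiv.norm_map, hx]) t
  have hmoment := lintegral_enorm_coeffMatrix_act_pow_mul_le t x
  rw [← ofReal_norm, hx, ENNReal.ofReal_one, one_pow, one_mul] at hmoment
  refine (ENNReal.mul_le_mul_iff_right (a := ENNReal.ofReal (c ^ t * D)) (by positivity)
    (by finiteness)).mp ?_
  calc ENNReal.ofReal (c ^ t * D) *
        ∫⁻ U, ENNReal.ofReal (excess c (act U x)) ∂unitaryHaar (α × β)
      = (∫⁻ U, ENNReal.ofReal (c ^ t) * ENNReal.ofReal (excess c (act U x))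
          ∂unitaryHaar (α × β)) * D := by
        rw [lintegral_const_mul' _ _ (by finiteness), ENNReal.ofReal_mul (by positivity),
          ENNReal.ofReal_natCast]
        ring
    _ ≤ (∫⁻ U, ‖coeffMatrix (act U x)‖ₑ ^ (2 * t) ∂unitaryHaar (α × β)) * D := by
        gcongr with U
        exact hpow U
    _ ≤ (Fintype.card α).ascFactorial t * (Fintype.card β).ascFactorial t := by
        simpa only [D, Nat.cast_mul] using hmoment
    _ ≤ ENNReal.ofReal (c ^ t * D) * ENNReal.ofReal p := by
        rw [← ENNReal.ofReal_mul (by positivity), ← Nat.cast_mul, ← ENNReal.ofReal_natCast]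
        refine ENNReal.ofReal_le_ofReal ?_
        simpa only [D, Nat.cast_mul, mul_comm p] using ht

theorem exists_unitaryGroup_sum_excess_le {p : ℝ} (hc : 0 ≤ c) (hp : 0 ≤ p)
    (hmean : ∀ x : EuclideanSpace ℂ (α × β), ‖x‖ = 1 →
      ∫⁻ U, ENNReal.ofReal (excess c (act U x)) ∂unitaryHaar (α × β) ≤ ENNReal.ofReal p)
    {δ : ℝ≥0} (hδ : 0 < δ) (n : ℕ) :
    ∃ U : Fin n → unitaryGroup (α × β) ℂ, ∀ x : EuclideanSpace ℂ (α × β), ‖x‖ = 1 →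
      ∑ k, excess c (act (U k) x) ≤
        2 * (Fintype.card α * Fintype.card β) * Real.log (1 + 2 / δ) + 2 * (p + δ) * n := by
  obtain ⟨N, hNsphere, hcover, hcard⟩ := exists_finset_isCover hδ
    (Metric.sphere_subset_closedBall : Metric.sphere (0 : EuclideanSpace ℂ (α × β)) 1 ⊆ _)
  have hN (y) (hy : y ∈ N) : ‖y‖ = 1 := mem_sphere_zero_iff_norm.mp (hNsphere hy)
  have hnorm (U : unitaryGroup (α × β) ℂ) {y} (hy : ‖y‖ = 1) : ‖act U y‖ = 1 := by
    rw [LinearIsometryEquiv.norm_map, hy]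
  obtain ⟨U, hU⟩ := exists_forall_sum_le_log_card_add (μ := unitaryHaar (α × β))
    (g := fun y U => excess c (act U y))
    (fun y _ => ((continuous_excess c).comp continuous_act.along_fst).measurable)
    (fun _ _ _ => excess_nonneg)
    (fun y hy U => (excess_le_sq_norm hc).trans_eq (by rw [hnorm U (hN y hy), one_pow]))
    hp (fun y hy => hmean y (hN y hy)) n
  refine ⟨U, fun x hx => ?_⟩
  obtain ⟨y, hy, hxy⟩ := hcover (mem_sphere_zero_iff_norm.mpr hx)
  have hdist : ‖x - y‖ ≤ δ := by
    rw [← dist_eq_norm]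
    exact_mod_cast hxy
  have hlog : Real.log N.card ≤
      2 * (Fintype.card α * Fintype.card β) * Real.log (1 + 2 / δ) := by
    have hNpos : (0 : ℝ) < N.card := by exact_mod_cast Finset.card_pos.mpr ⟨y, hy⟩
    refine (Real.log_le_log hNpos hcard).trans_eq ?_
    rw [Real.log_pow, ← finrank_mul_finrank ℝ ℂ (EuclideanSpace ℂ (α × β)),
      Complex.finrank_real_complex, finrank_euclideanSpace, Fintype.card_prod]
    push_cast
    ring
  calc ∑ k, excess c (act (U k) x)
      ≤ ∑ k, (excess c (act (U k) y) + 2 * δ) := by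
        refine Finset.sum_le_sum fun k _ => ?_
        refine (excess_le_excess_add (hnorm (U k) hx) (hnorm (U k) (hN y hy))).trans ?_
        rw [← map_sub, LinearIsometryEquiv.norm_map]
        gcongr
    _ = ∑ k, excess c (act (U k) y) + 2 * δ * n := by
        simp [Finset.sum_add_distrib, mul_comm]
    _ ≤ 2 * (Fintype.card α * Fintype.card β) * Real.log (1 + 2 / δ) + 2 * (p + δ) * n := by
        linarith [hU y hy]

theorem sum_excess_act_le_mul_sq_norm {κ : Type*} [Fintype κ] {U : κ → unitaryGroup (α × β) ℂ}
    {η : ℝ} (hU : ∀ x : EuclideanSpace ℂ (α × β), ‖x‖ = 1 → ∑ k, excess c (act (U k) x) ≤ η)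
    (x : EuclideanSpace ℂ (α × β)) : ∑ k, excess c (act (U k) x) ≤ η * ‖x‖ ^ 2 := by
  obtain rfl | hx := eq_or_ne x 0
  · simp [excess]
  · have hunit := hU (‖x‖⁻¹ • x) (by simp [norm_smul, hx])
    simp only [fun k => map_real_smul (act (U k)) (act (U k)).continuous, excess_smul,
      ← Finset.mul_sum] at hunit
    rwa [inv_pow, inv_mul_le_iff₀ (by positivity), mul_comm] at hunit

theorem sum_max_opNorm_reducedState_sub_le {κ α₁ ι : Type*} [Fintype κ] [Fintype α₁]
    [DecidableEq α₁] [Fintype ι] [DecidableEq ι] {U : κ → unitaryGroup (α × β) ℂ} {η : ℝ}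
    (hU : ∀ x : EuclideanSpace ℂ (α × β), ∑ k, excess c (act (U k) x) ≤ η * ‖x‖ ^ 2)
    {V : Matrix (α × β) ι ℂ} (hV : IsIsometry V) (ψ : EuclideanSpace ℂ (α₁ × ι)) :
    ∑ k, max 0 (opNorm (reducedState ((U k : Matrix (α × β) (α × β) ℂ) * V) ψ) - c * ‖ψ‖ ^ 2) ≤
      η * ‖ψ‖ ^ 2 := by
  let x (i : α₁) : EuclideanSpace ℂ (α × β) := WithLp.toLp 2 (V *ᵥ fun j => ψ (i, j))
  have hx : ∑ i, ‖x i‖ ^ 2 = ‖ψ‖ ^ 2 := by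
    simp only [x, hV.norm_mulVec, EuclideanSpace.norm_sq_eq, Fintype.sum_prod_type]
  have hle (k) : max 0 (opNorm (reducedState ((U k : Matrix (α × β) (α × β) ℂ) * V) ψ) -
      c * ‖ψ‖ ^ 2) ≤ ∑ i, excess c (act (U k) (x i)) := by
    refine max_le (Finset.sum_nonneg fun _ _ => excess_nonneg) (sub_le_iff_le_add'.mpr ?_)
    rw [← hx, Finset.mul_sum, ← Finset.sum_add_distrib]
    refine (opNorm_reducedState_le _ ψ).trans (Finset.sum_le_sum fun i _ => ?_)
    rw [← mulVec_mulVec, ← LinearIsometryEquiv.norm_map (act (U k)) (x i)]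
    exact sq_norm_coeffMatrix_le_add_excess c _
  calc _ ≤ ∑ k, ∑ i, excess c (act (U k) (x i)) := Finset.sum_le_sum fun k _ => hle k
    _ ≤ ∑ i, η * ‖x i‖ ^ 2 := by
        rw [Finset.sum_comm]
        exact Finset.sum_le_sum fun i _ => hU (x i)
    _ = η * ‖ψ‖ ^ 2 := by rw [← Finset.mul_sum, hx]

theorem one_sub_le_ncard_lt_div {n : ℕ} (hn : 0 < n) {f : Fin n → ℝ} {c s ε : ℝ} (hs : 0 < s)
    (hf : ∑ k, max 0 (f k - c) ≤ ε * n * s) : 1 - ε ≤ ({k | f k < c + s}.ncard : ℝ) / n := by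
  classical
  have hmarkov : (({k | ¬ f k < c + s} : Finset (Fin n)).card : ℝ) * s ≤ ε * n * s := by
    rw [← nsmul_eq_mul]
    refine (Finset.card_nsmul_le_sum _ (fun k => max 0 (f k - c)) s fun k hk => ?_).trans
      ((Finset.sum_le_univ_sum_of_nonneg fun _ => le_max_left _ _).trans hf)
    exact le_max_of_le_right (by linarith [not_lt.mp (Finset.mem_filter.mp hk).2])
  have hfail := le_of_mul_le_mul_right hmarkov hs
  have hsplit : (({k | f k < c + s} : Finset (Fin n)).card : ℝ) +
      ({k | ¬ f k < c + s} : Finset (Fin n)).card = n := by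
    have h := Finset.card_filter_add_card_filter_not (s := (Finset.univ : Finset (Fin n)))
      fun k => f k < c + s
    rw [Finset.card_univ, Fintype.card_fin] at h
    exact_mod_cast h
  have hncard : {k | f k < c + s}.ncard = ({k | f k < c + s} : Finset (Fin n)).card := by
    rw [← Set.ncard_coe_finset, Finset.coe_filter_univ]
  rw [le_div_iff₀ (by exact_mod_cast hn), hncard]
  linarith

end RandomUnitaries

section Estimates

theorem ascFactorial_mul_pow_le {a : ℕ} (ha : 0 < a) (d t : ℕ) :
    (a.ascFactorial t * d ^ t : ℝ) ≤ (a * d).ascFactorial t * Real.exp (t ^ 2 / (2 * a)) := by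
  have ha' : (0 : ℝ) < a := by exact_mod_cast ha
  induction t with
  | zero => simp
  | succ t ih =>
    have hfactor : (a + t : ℝ) * d ≤
        (a * d + t) * Real.exp (((t + 1 : ℝ) ^ 2 - t ^ 2) / (2 * a)) := by
      calc (a + t : ℝ) * d = a * d * (t / a + 1) := by field_simp; ring
        _ ≤ a * d * Real.exp (t / a) := by gcongr; exact Real.add_one_le_exp _
        _ ≤ (a * d + t) * Real.exp (((t + 1 : ℝ) ^ 2 - t ^ 2) / (2 * a)) := by
          gcongr ?_ * Real.exp ?_
          · linarith [t.cast_nonneg (α := ℝ)]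
          · rw [div_le_div_iff₀ ha' (by positivity)]
            nlinarith
    rw [Nat.ascFactorial_succ, Nat.ascFactorial_succ, pow_succ]
    push_cast
    calc (a + t : ℝ) * a.ascFactorial t * (d ^ t * d)
        = ((a + t) * d) * (a.ascFactorial t * d ^ t) := by ring
      _ ≤ ((a * d + t) * Real.exp (((t + 1 : ℝ) ^ 2 - t ^ 2) / (2 * a))) *
          ((a * d).ascFactorial t * Real.exp (t ^ 2 / (2 * a))) := by gcongr
      _ = (a * d + t) * (a * d).ascFactorial t *
          Real.exp (((t + 1 : ℝ) ^ 2 - t ^ 2) / (2 * a) + t ^ 2 / (2 * a)) := by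
        rw [Real.exp_add]
        ring
      _ = (a * d + t) * (a * d).ascFactorial t * Real.exp ((t + 1) ^ 2 / (2 * a)) := by
        rw [← add_div, sub_add_cancel]

theorem ascFactorial_le_factorial_mul_pow {d : ℕ} (hd : 0 < d) (t : ℕ) :
    d.ascFactorial t ≤ t.factorial * (d + t) ^ d := by
  obtain ⟨k, rfl⟩ := Nat.exists_eq_add_one.mpr hd
  rw [Nat.ascFactorial_eq_factorial_mul_choose, ← Nat.choose_symm_add]
  gcongr
  calc (k + t).choose k ≤ (k + t) ^ k := Nat.choose_le_pow _ _
    _ ≤ (k + 1 + t) ^ k := by gcongr; omega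
    _ ≤ (k + 1 + t) ^ (k + 1) := Nat.pow_le_pow_right (by omega) (by omega)

theorem sq_ceil_div_sub_le {b a : ℝ} (hb : 0 ≤ b) (ha : 1 ≤ a) :
    (⌈b * a⌉₊ : ℝ) ^ 2 / (2 * a) - b * ⌈b * a⌉₊ ≤ 1 - b ^ 2 * a / 2 := by
  have hle := Nat.le_ceil (b * a)
  have hlt := Nat.ceil_lt_add_one (mul_nonneg hb (zero_le_one.trans ha))
  rw [sub_le_iff_le_add, div_le_iff₀ (by positivity)]
  nlinarith

theorem exp_le_one_add_half {ε : ℝ} (hε : 0 ≤ ε) (hε1 : ε ≤ 1) :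
    Real.exp (7 / 20 * ε) ≤ 1 + ε / 2 := by
  have h := le_of_abs_le (Real.abs_exp_sub_one_sub_id_le (x := 7 / 20 * ε)
    (abs_le.mpr ⟨by linarith, by linarith⟩))
  nlinarith

theorem two_le_log {x : ℝ} (hx : 10 ≤ x) : 2 ≤ Real.log x := by
  rw [Real.le_log_iff_exp_le (by linarith), show (2 : ℝ) = 1 + 1 by norm_num, Real.exp_add]
  nlinarith [Real.exp_one_lt_d9, Real.exp_pos 1]

variable {ε : ℝ} {a d : ℕ}

theorem ten_le_of_ten_le_mul (hε1 : ε ≤ 1) (hd : 10 ≤ ε * d) : (10 : ℝ) ≤ d :=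
  hd.trans (mul_le_of_le_one_left d.cast_nonneg hε1)

theorem le_of_mul_log_le (hε : 0 < ε) (hε1 : ε ≤ 1) (hd : 10 ≤ ε * d)
    (ha : 112 * (d * Real.log d) ≤ ε ^ 2 * a) : d ≤ a := by
  have hlog := two_le_log (ten_le_of_ten_le_mul hε1 hd)
  have hle : (d : ℝ) ≤ a := by
    calc (d : ℝ) ≤ 112 * (d * Real.log d) := by nlinarith [d.cast_nonneg (α := ℝ)]
      _ ≤ ε ^ 2 * a := ha
      _ ≤ a := mul_le_of_le_one_left a.cast_nonneg (pow_le_one₀ hε.le hε1)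
  exact_mod_cast hle

theorem add_ceil_le_pow_four (hε : 0 < ε) (hε1 : ε ≤ 1) (hd : 10 ≤ ε * d)
    (ha : ε ^ 2 * a ≤ 113 * (d * Real.log d)) : (d + ⌈7 / 20 * ε * a⌉₊ : ℝ) ≤ d ^ 4 := by
  have hd10 := ten_le_of_ten_le_mul hε1 hd
  have hlog : Real.log d ≤ d := Real.log_le_self (by linarith)
  have hεa : 10 * (ε * a) ≤ 113 * d ^ 3 := by
    calc 10 * (ε * a) ≤ ε * d * (ε * a) := by gcongr
      _ = d * (ε ^ 2 * a) := by ring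
      _ ≤ d * (113 * (d * Real.log d)) := by gcongr ?_ * ?_
      _ ≤ d * (113 * (d * d)) := by gcongr
      _ = 113 * d ^ 3 := by ring
  have ht := Nat.ceil_lt_add_one (by positivity : 0 ≤ 7 / 20 * ε * a)
  have hcube : (10 : ℝ) ^ 2 * d ≤ d ^ 2 * d := by gcongr
  have hfour : (10 : ℝ) * d ^ 3 ≤ d * d ^ 3 := by gcongr
  linarith

theorem exp_mul_add_ceil_pow_le (hε : 0 < ε) (hε1 : ε ≤ 1) (hd : 10 ≤ ε * d)
    (ha : 112 * (d * Real.log d) ≤ ε ^ 2 * a) (ha' : ε ^ 2 * a ≤ 113 * (d * Real.log d)) :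
    Real.exp (⌈7 / 20 * ε * a⌉₊ ^ 2 / (2 * a)) * (d + ⌈7 / 20 * ε * a⌉₊ : ℝ) ^ d ≤
      1 / d ^ 3 * (1 + ε / 2) ^ ⌈7 / 20 * ε * a⌉₊ := by
  have hd10 := ten_le_of_ten_le_mul hε1 hd
  have hlog := two_le_log hd10
  have hda : (d : ℝ) ≤ a := by exact_mod_cast le_of_mul_log_le hε hε1 hd ha
  have hpow := add_ceil_le_pow_four hε hε1 hd ha'
  have hexponent := sq_ceil_div_sub_le (by positivity : 0 ≤ 7 / 20 * ε) (by linarith : (1 : ℝ) ≤ a)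
  set t := ⌈7 / 20 * ε * a⌉₊
  have hpow_eq_exp (k : ℕ) : (d : ℝ) ^ k = Real.exp (k * Real.log d) := by
    rw [Real.exp_nat_mul, Real.exp_log (by linarith)]
  calc Real.exp (t ^ 2 / (2 * a)) * (d + t : ℝ) ^ d
      ≤ Real.exp (t ^ 2 / (2 * a)) * (d ^ 4) ^ d := by gcongr
    _ = Real.exp (t ^ 2 / (2 * a) + 4 * d * Real.log d) := by
        rw [← pow_mul, hpow_eq_exp, ← Real.exp_add]
        push_cast
        rfl
    _ ≤ Real.exp (-(3 * Real.log d) + 7 / 20 * ε * t) := by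
        gcongr Real.exp ?_
        nlinarith
    _ = 1 / d ^ 3 * Real.exp (7 / 20 * ε) ^ t := by
        rw [Real.exp_add, Real.exp_neg, hpow_eq_exp, one_div, mul_comm _ (t : ℝ), Real.exp_nat_mul]
        push_cast
        rfl
    _ ≤ 1 / d ^ 3 * (1 + ε / 2) ^ t := by
        gcongr
        exact exp_le_one_add_half hε.le hε1

theorem exists_ascFactorial_mul_ascFactorial_le (hε : 0 < ε) (hε1 : ε ≤ 1) (hd : 10 ≤ ε * d)
    (ha : 112 * (d * Real.log d) ≤ ε ^ 2 * a) (ha' : ε ^ 2 * a ≤ 113 * (d * Real.log d)) :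
    ∃ t : ℕ, (a.ascFactorial t * d.ascFactorial t : ℝ) ≤
      1 / d ^ 3 * (((1 + ε / 2) / d) ^ t * (t.factorial * (a * d).ascFactorial t)) := by
  have hd0 : (0 : ℝ) < d := by linarith [ten_le_of_ten_le_mul hε1 hd]
  have ha0 : 0 < a := (Nat.cast_pos.mp hd0).trans_le (le_of_mul_log_le hε hε1 hd ha)
  have hexp := exp_mul_add_ceil_pow_le hε hε1 hd ha ha'
  refine ⟨⌈7 / 20 * ε * a⌉₊, ?_⟩
  set t := ⌈7 / 20 * ε * a⌉₊
  have hB : (d.ascFactorial t : ℝ) ≤ t.factorial * (d + t) ^ d := by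
    exact_mod_cast ascFactorial_le_factorial_mul_pow (Nat.cast_pos.mp hd0) t
  calc (a.ascFactorial t * d.ascFactorial t : ℝ)
      = (a.ascFactorial t * d ^ t) * d.ascFactorial t / d ^ t := by field_simp
    _ ≤ ((a * d).ascFactorial t * Real.exp (t ^ 2 / (2 * a))) *
        (t.factorial * (d + t) ^ d) / d ^ t := by
        gcongr ?_ * ?_ / _
        exact ascFactorial_mul_pow_le ha0 d t
    _ = (Real.exp (t ^ 2 / (2 * a)) * (d + t) ^ d) *
        (t.factorial * (a * d).ascFactorial t) / d ^ t := by ring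
    _ ≤ (1 / d ^ 3 * (1 + ε / 2) ^ t) * (t.factorial * (a * d).ascFactorial t) / d ^ t := by gcongr
    _ = 1 / d ^ 3 * (((1 + ε / 2) / d) ^ t * (t.factorial * (a * d).ascFactorial t)) := by
        rw [div_pow]
        ring

theorem two_mul_log_add_le {n : ℕ} (hε : 0 < ε) (hε1 : ε ≤ 1) (hd : 10 ≤ ε * d)
    (ha : ε ^ 2 * a ≤ 113 * (d * Real.log d))
    (hn : 13440 * (d ^ 3 * Real.log d ^ 2) ≤ ε ^ 5 * n) :
    2 * (a * d) * Real.log (1 + 2 / (1 / d ^ 3)) + 2 * (1 / d ^ 3 + 1 / d ^ 3) * n ≤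
      ε * n * (ε / (2 * d)) := by
  have hd10 := ten_le_of_ten_le_mul hε1 hd
  have hlogd := two_le_log hd10
  have hcube : (10 : ℝ) ^ 3 ≤ d ^ 3 := by gcongr
  have hlog : Real.log (1 + 2 / (1 / d ^ 3)) ≤ 4 * Real.log d := by
    rw [show 4 * Real.log d = Real.log (d ^ 4) by rw [Real.log_pow]; norm_num]
    gcongr
    rw [div_div_eq_mul_div, div_one]
    nlinarith
  have hnet : 32 * (a * d ^ 2 * Real.log d) ≤ ε ^ 2 * n := by
    refine le_of_mul_le_mul_left ?_ (by positivity : 0 < ε ^ 3)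
    calc ε ^ 3 * (32 * (a * d ^ 2 * Real.log d))
        = ε * (32 * (d ^ 2 * Real.log d) * (ε ^ 2 * a)) := by ring
      _ ≤ 1 * (32 * (d ^ 2 * Real.log d) * (113 * (d * Real.log d))) := by gcongr
      _ ≤ 13440 * (d ^ 3 * Real.log d ^ 2) := by
        linarith [(by positivity : 0 ≤ d ^ 3 * Real.log d ^ 2)]
      _ ≤ ε ^ 3 * (ε ^ 2 * n) := by linarith
  have hmean : 16 * n ≤ ε ^ 2 * n * d ^ 2 := by
    have : (10 : ℝ) ^ 2 ≤ (ε * d) ^ 2 := by gcongr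
    nlinarith [n.cast_nonneg (α := ℝ)]
  calc 2 * (a * d) * Real.log (1 + 2 / (1 / d ^ 3)) + 2 * (1 / d ^ 3 + 1 / d ^ 3) * n
      ≤ 2 * (a * d) * (4 * Real.log d) + 2 * (1 / d ^ 3 + 1 / d ^ 3) * n := by gcongr
    _ = 32 * (a * d ^ 2 * Real.log d) / (4 * d) + 16 * n / (4 * d ^ 3) := by
        field_simp
        ring
    _ ≤ ε ^ 2 * n / (4 * d) + ε ^ 2 * n * d ^ 2 / (4 * d ^ 3) := by gcongr
    _ = ε * n * (ε / (2 * d)) := by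
        field_simp
        ring

end Estimates

section Parameters

variable {ε : ℝ} {a d n : ℕ}

theorem exists_unitaryGroup_forall_sum_excess_le (hε : 0 < ε) (hε1 : ε ≤ 1) (hd : 10 ≤ ε * d)
    (ha : 112 * (d * Real.log d) ≤ ε ^ 2 * a) (ha' : ε ^ 2 * a ≤ 113 * (d * Real.log d))
    (hn : 13440 * (d ^ 3 * Real.log d ^ 2) ≤ ε ^ 5 * n) :
    ∃ U : Fin n → unitaryGroup (Fin a × Fin d) ℂ, ∀ x : EuclideanSpace ℂ (Fin a × Fin d),
      ∑ k, excess ((1 + ε / 2) / d) (act (U k) x) ≤ ε * n * (ε / (2 * d)) * ‖x‖ ^ 2 := by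
  have hd0 : 0 < d := Nat.cast_pos.mp (by linarith [ten_le_of_ten_le_mul hε1 hd] : (0 : ℝ) < d)
  have : NeZero d := .of_pos hd0
  have : NeZero a := .of_pos (hd0.trans_le (le_of_mul_log_le hε hε1 hd ha))
  have hc : 0 < (1 + ε / 2) / d := by positivity
  obtain ⟨t, ht⟩ := exists_ascFactorial_mul_ascFactorial_le hε hε1 hd ha ha'
  obtain ⟨U, hU⟩ := exists_unitaryGroup_sum_excess_le (α := Fin a) (β := Fin d) hc.le
    (by positivity : 0 ≤ 1 / (d : ℝ) ^ 3)
    (fun x => lintegral_excess_act_le hc t (by simpa only [Fintype.card_fin] using ht))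
    (one_div_pos.mpr (pow_pos (Nat.cast_pos.mpr hd0) 3)) n
  refine ⟨U, sum_excess_act_le_mul_sq_norm fun x hx => (hU x hx).trans ?_⟩
  simpa using two_mul_log_add_le hε hε1 hd ha' hn

theorem dimA₂_bounds (hε : 0 < ε) (hε1 : ε ≤ 1) (hd : 10 ≤ ε * d) :
    112 * (d * Real.log d) ≤ ε ^ 2 * dimA₂ ε d ∧
      ε ^ 2 * dimA₂ ε d ≤ 113 * (d * Real.log d) := by
  have hd10 := ten_le_of_ten_le_mul hε1 hd
  have hlog := two_le_log hd10
  have heq : 112 * Real.log 2 / ε ^ 2 * (d * Real.logb 2 d) = 112 * (d * Real.log d) / ε ^ 2 := by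
    rw [Real.logb]
    field_simp
  rw [dimA₂, heq]
  have hle := Nat.le_ceil (112 * (d * Real.log d) / ε ^ 2)
  have hlt := Nat.ceil_lt_add_one (by positivity : 0 ≤ 112 * (d * Real.log d) / ε ^ 2)
  refine ⟨(div_le_iff₀' (by positivity)).mp hle, ?_⟩
  calc ε ^ 2 * (⌈112 * (d * Real.log d) / ε ^ 2⌉₊ : ℝ)
      ≤ ε ^ 2 * (112 * (d * Real.log d) / ε ^ 2 + 1) := by gcongr
    _ = 112 * (d * Real.log d) + ε ^ 2 := by field_simp
    _ ≤ 113 * (d * Real.log d) := by nlinarith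

theorem le_numIsometries (hε : 0 < ε) (d : ℕ) :
    13440 * (d ^ 3 * Real.log d ^ 2) ≤ ε ^ 5 * numIsometries ε d := by
  have heq : 13440 * Real.log 2 ^ 2 / ε ^ 5 * ((d : ℝ) ^ 3 * Real.logb 2 d ^ 2) =
      13440 * (d ^ 3 * Real.log d ^ 2) / ε ^ 5 := by
    rw [Real.logb]
    field_simp
  rw [numIsometries, heq]
  exact (div_le_iff₀' (by positivity)).mp (Nat.le_ceil _)

theorem numIsometries_pos (hε : 0 < ε) (hε1 : ε ≤ 1) (hd : 10 ≤ ε * d) :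
    0 < numIsometries ε d := by
  have hd10 := ten_le_of_ten_le_mul hε1 hd
  have hlog := two_le_log hd10
  have hpos : 0 < ε ^ 5 * numIsometries ε d :=
    (by positivity : 0 < 13440 * (d ^ 3 * Real.log d ^ 2)).trans_le (le_numIsometries hε d)
  exact_mod_cast pos_of_mul_pos_right hpos (by positivity)

end Parameters

end SuperdenseCoding

/-- The case `m = d ^ 2` is that of isometries defined on a `d²`-dimensional space; the case
`m = dim A₂ * d` is that of unitaries of `A₂ ⊗ B` and of arbitrary pure states of `A₁A₂B`. -/
theorem lemma2 (ε : ℝ) (hε : 0 < ε) (hε1 : ε ≤ 1) (d : ℕ) (hd : 10 / ε ≤ (d : ℝ)) :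
    d ^ 2 ≤ SuperdenseCoding.dimA₂ ε d * d ∧
    ∀ m : ℕ, m ≤ SuperdenseCoding.dimA₂ ε d * d →
      ∃ U : Fin (SuperdenseCoding.numIsometries ε d) →
          Matrix (Fin (SuperdenseCoding.dimA₂ ε d) × Fin d) (Fin m) ℂ,
        (∀ k, SuperdenseCoding.IsIsometry (U k)) ∧
        ∀ (r : ℕ) (ψ : EuclideanSpace ℂ (Fin r × Fin m)), ‖ψ‖ = 1 →
          1 - ε ≤
            (Set.ncard {k | SuperdenseCoding.opNorm (SuperdenseCoding.reducedState (U k) ψ)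
                < (1 + ε) / d} : ℝ) / (SuperdenseCoding.numIsometries ε d : ℝ) := by
  have hdε : 10 ≤ ε * d := (div_le_iff₀' hε).mp hd
  obtain ⟨ha, ha'⟩ := SuperdenseCoding.dimA₂_bounds hε hε1 hdε
  have hn := SuperdenseCoding.le_numIsometries hε d
  have hda := SuperdenseCoding.le_of_mul_log_le hε hε1 hdε ha
  refine ⟨sq d ▸ Nat.mul_le_mul_right d hda, fun m hm => ?_⟩
  obtain ⟨W, hW⟩ := SuperdenseCoding.exists_unitaryGroup_forall_sum_excess_le hε hε1 hdε ha ha' hn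
  let e : Fin m ↪ Fin (SuperdenseCoding.dimA₂ ε d) × Fin d :=
    (Fin.castLEEmb hm).trans finProdFinEquiv.symm.toEmbedding
  have hV := SuperdenseCoding.isIsometry_one_submatrix e
  refine ⟨_, fun k => hV.unitary_mul (W k), fun r ψ hψ => ?_⟩
  have hsum := SuperdenseCoding.sum_max_opNorm_reducedState_sub_le hW hV ψ
  have hd0 : (0 : ℝ) < d := by linarith [SuperdenseCoding.ten_le_of_ten_le_mul hε1 hdε]
  have hthreshold : (1 + ε) / d = (1 + ε / 2) / d + ε / (2 * d) := by
    field_simp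
    ring
  rw [hthreshold]
  simp only [hψ, one_pow, mul_one] at hsum
  exact SuperdenseCoding.one_sub_le_ncard_lt_div
    (SuperdenseCoding.numIsometries_pos hε hε1 hdε) (by positivity) hsum
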